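/- For an integer $n>1$ define $f=f_n:\{0,1\}^n\times\{0,1\}^n\to\{0,1\}$ by $f(x,y)=1$ iff $|x\wedge y|\neq 1$, where $x\wedge y$ is the bitwise AND and $|z|$ denotes the number of ones in $z$; let $\overline f=1-f$. A classical nondeterministic protocol for a function $g:\{0,1\}^n\times\{0,1\}^n\to\{0,1\}$ is a two-party communication protocol in which Alice receives $x$, Bob receives $y$, each player has a private random string (the two strings being independent), the players exchange bits according to a protocol tree whose leaves are labelled by the output bit (so both players know the output at the end), and the probability of output $1$ on input $(x,y)$ is positive if and only if $g(x,y)=1$. Its cost is the number of bits exchanged in the worst case, and $\mathrm{Ncc}(g)$ is the minimal cost of such a protocol for $g$. Then $\mathrm{Ncc}(f)\in\Omega(n)$, i.e. there are a constant $c>0$ and an $N$ such that $\mathrm{Ncc}(f_n)\ge c\,n$ for all $n>1$ with $n\geq N$; and $\mathrm{Ncc}(\overline{f})\ge n-1$ for every $n>1$. -/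

import Mathlib

/-- A two-party protocol tree. Alice holds an element of `U`, Bob an element of `V`. At an inner
node the owner of the node sends one bit, computed from what that player holds, and both players
move to the corresponding child (`zero` or `one`). A leaf carries the output bit, so the output is
determined by the transcript and is known to both players. -/
inductive ProtocolTree (U V : Type) : Type
  | leaf (out : Bool) : ProtocolTree U V
  | alice (bit : U → Bool) (zero one : ProtocolTree U V) : ProtocolTree U V
  | bob (bit : V → Bool) (zero one : ProtocolTree U V) : ProtocolTree U V

namespace ProtocolTree

variable {U V : Type}

/-- The output of the protocol when Alice holds `u` and Bob holds `v`. -/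
def run : ProtocolTree U V → U → V → Bool
  | leaf out, _, _ => out
  | alice bit zero one, u, v => if bit u then one.run u v else zero.run u v
  | bob bit zero one, u, v => if bit v then one.run u v else zero.run u v

/-- The height of the tree: the number of bits exchanged in the worst case. -/
def height : ProtocolTree U V → ℕ
  | leaf _ => 0
  | alice _ zero one => max zero.height one.height + 1
  | bob _ zero one => max zero.height one.height + 1

end ProtocolTree

/-- A classical randomized (private-coin) protocol on inputs from `X` and `Y`: besides the inputs,
Alice and Bob each have a private random bit string of arbitrary length, drawn independently of
each other from fixed distributions. -/
structure RandomizedProtocol (X Y : Type) where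
  /-- Distribution of Alice's random string. -/
  coinsA : PMF (List Bool)
  /-- Distribution of Bob's random string. -/
  coinsB : PMF (List Bool)
  /-- The protocol run on the inputs together with the random strings. -/
  tree : ProtocolTree (X × List Bool) (Y × List Bool)

namespace RandomizedProtocol

variable {X Y : Type}

/-- The distribution of the output bit on input `(x, y)`. -/
noncomputable def outputDist (P : RandomizedProtocol X Y) (x : X) (y : Y) : PMF Bool :=
  P.coinsA.bind fun r => P.coinsB.bind fun s => PMF.pure (P.tree.run (x, r) (y, s))

/-- The acceptance probability on input `(x, y)`. -/
noncomputable def acceptProb (P : RandomizedProtocol X Y) (x : X) (y : Y) : ENNReal :=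
  P.outputDist x y true

/-- The communication cost: the number of bits exchanged in the worst case. -/
def cost (P : RandomizedProtocol X Y) : ℕ := P.tree.height

/-- `P` is a nondeterministic protocol for `f`: its acceptance probability on `(x, y)` is positive
if and only if `f x y = 1`. -/
def IsNondeterministicFor (P : RandomizedProtocol X Y) (f : X → Y → Bool) : Prop :=
  ∀ x y, 0 < P.acceptProb x y ↔ f x y = true

end RandomizedProtocol

/-- The classical nondeterministic communication complexity of `f`: the least cost of a
nondeterministic protocol for `f`. -/
noncomputable def Ncc {X Y : Type} (f : X → Y → Bool) : ℕ :=
  sInf {c | ∃ P : RandomizedProtocol X Y, P.IsNondeterministicFor f ∧ P.cost = c}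

/-- If Alice has finitely many inputs, nondeterministic protocols for `f` exist, so the infimum
in `Ncc` is a minimum. -/
theorem exists_isNondeterministicFor {X Y : Type} [Finite X] (f : X → Y → Bool) :
    ∃ P : RandomizedProtocol X Y, P.IsNondeterministicFor f := by
  classical
  have key : ∀ L : List X, ∃ T : ProtocolTree (X × List Bool) (Y × List Bool),
      ∀ x ∈ L, ∀ r y s, T.run (x, r) (y, s) = f x y := by
    intro L
    induction L with
    | nil => exact ⟨.leaf false, by simp⟩
    | cons a L ih =>
      obtain ⟨T, hT⟩ := ih
      refine ⟨.alice (fun u => decide (u.1 = a)) T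
        (.bob (fun v => f a v.1) (.leaf false) (.leaf true)), ?_⟩
      intro x hx r y s
      by_cases h : x = a
      · subst h
        cases hf : f x y <;> simp [ProtocolTree.run, hf]
      · have hx' : x ∈ L := by simpa [h] using hx
        simpa [ProtocolTree.run, h] using hT x hx' r y s
  obtain ⟨L, hL⟩ : ∃ L : List X, ∀ x, x ∈ L := by
    haveI := Fintype.ofFinite X
    exact ⟨Finset.univ.toList, by simp⟩
  obtain ⟨T, hT⟩ := key L
  refine ⟨⟨PMF.pure [], PMF.pure [], T⟩, fun x y => ?_⟩
  simp only [RandomizedProtocol.acceptProb, RandomizedProtocol.outputDist, PMF.pure_bind,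
    hT x (hL x), PMF.pure_apply]
  cases f x y <;> simp

/-- The Hamming weight `|z|` of a bit string. -/
def weight {n : ℕ} (z : Fin n → Bool) : ℕ := (Finset.univ.filter fun i => z i = true).card

/-- The function `f(x, y) = 1` iff `|x ∧ y| ≠ 1`, with `x ∧ y` the bitwise AND. -/
def fNotOne (n : ℕ) (x y : Fin n → Bool) : Bool := decide (weight (fun i => x i && y i) ≠ 1)

/-- The complement of a Boolean function of two arguments. -/
def complementFn {X Y : Type} (f : X → Y → Bool) (x : X) (y : Y) : Bool := !(f x y)

/-! Only positivity of the acceptance probability matters, so a protocol of cost `c` covers the ones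
of its function by `2 ^ c` rectangles of ones (`Ncc_exists_rectangle_cover`). For `fNotOne`, count
the `3 ^ n` disjoint pairs: all are ones, but a rectangle of ones holds at most `2 ^ n` of them
(`sum_disjoint_pairs_le`), so at least `(3/2) ^ n` rectangles are needed. For the complement, the
pairs with a shared leading one and complementary tails form a fooling set of size `2 ^ (n - 1)`. -/

/-- A protocol tree of height `h` accepts on a union of at most `2 ^ h` combinatorial rectangles. -/
theorem ProtocolTree.exists_rectangle_cover {U V : Type} (T : ProtocolTree U V) :
    ∃ R : Finset (Set U × Set V), R.card ≤ 2 ^ T.height ∧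
      ∀ u v, T.run u v = true ↔ ∃ r ∈ R, u ∈ r.1 ∧ v ∈ r.2 := by
  classical
  have card_bound : ∀ (a b : ℕ) (S S' : Finset (Set U × Set V)), S.card ≤ 2 ^ a → S'.card ≤ 2 ^ b →
      (S ∪ S').card ≤ 2 ^ (max a b + 1) := by
    intro a b S S' hS hS'
    have h₁ : 2 ^ a ≤ 2 ^ max a b := Nat.pow_le_pow_right (by norm_num) (le_max_left a b)
    have h₂ : 2 ^ b ≤ 2 ^ max a b := Nat.pow_le_pow_right (by norm_num) (le_max_right a b)
    have h₃ := Finset.card_union_le S S'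
    rw [pow_succ]
    omega
  induction T with
  | leaf out =>
    cases out
    · exact ⟨∅, by simp, by simp [run]⟩
    · exact ⟨{(Set.univ, Set.univ)}, by simp [height], by simp [run]⟩
  | alice bit zero one ih₀ ih₁ =>
    obtain ⟨R₀, hc₀, h₀⟩ := ih₀
    obtain ⟨R₁, hc₁, h₁⟩ := ih₁
    refine ⟨R₀.image (fun r => ({u | bit u = false} ∩ r.1, r.2)) ∪
      R₁.image (fun r => ({u | bit u = true} ∩ r.1, r.2)),
      card_bound _ _ _ _ (Finset.card_image_le.trans hc₀) (Finset.card_image_le.trans hc₁), ?_⟩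
    intro u v
    cases hb : bit u
    · simp [run, hb, h₀, or_and_right, exists_or]
    · simp [run, hb, h₁, or_and_right, exists_or]
  | bob bit zero one ih₀ ih₁ =>
    obtain ⟨R₀, hc₀, h₀⟩ := ih₀
    obtain ⟨R₁, hc₁, h₁⟩ := ih₁
    refine ⟨R₀.image (fun r => (r.1, {v | bit v = false} ∩ r.2)) ∪
      R₁.image (fun r => (r.1, {v | bit v = true} ∩ r.2)),
      card_bound _ _ _ _ (Finset.card_image_le.trans hc₀) (Finset.card_image_le.trans hc₁), ?_⟩
    intro u v
    cases hb : bit v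
    · simp [run, hb, h₀, or_and_right, exists_or]
    · simp [run, hb, h₁, or_and_right, exists_or]

theorem RandomizedProtocol.acceptProb_pos_iff {X Y : Type} (P : RandomizedProtocol X Y) (x : X)
    (y : Y) : 0 < P.acceptProb x y ↔
      ∃ r ∈ P.coinsA.support, ∃ s ∈ P.coinsB.support, P.tree.run (x, r) (y, s) = true := by
  rw [acceptProb, pos_iff_ne_zero, ← PMF.mem_support_iff, outputDist, PMF.mem_support_bind_iff]
  simp only [PMF.mem_support_bind_iff, PMF.mem_support_pure_iff, eq_comm]

/-- The ones of `f` are covered by at most `2 ^ c` rectangles of ones if `f` has a nondeterministic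
protocol of cost `c`. -/
theorem RandomizedProtocol.IsNondeterministicFor.exists_rectangle_cover {X Y : Type}
    {P : RandomizedProtocol X Y} {f : X → Y → Bool} (hP : P.IsNondeterministicFor f) :
    ∃ R : Finset (Set X × Set Y), R.card ≤ 2 ^ P.cost ∧
      ∀ x y, f x y = true ↔ ∃ r ∈ R, x ∈ r.1 ∧ y ∈ r.2 := by
  classical
  obtain ⟨R, hc, hR⟩ := P.tree.exists_rectangle_cover
  -- Independent coins can be chosen separately, so projecting them away leaves a rectangle.
  refine ⟨R.image (fun r => ({x | ∃ a ∈ P.coinsA.support, (x, a) ∈ r.1},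
    {y | ∃ b ∈ P.coinsB.support, (y, b) ∈ r.2})), Finset.card_image_le.trans hc, fun x y => ?_⟩
  rw [← hP x y, P.acceptProb_pos_iff]
  simp only [hR, Finset.exists_mem_image, Set.mem_ofPred_eq]
  constructor
  · rintro ⟨a, ha, b, hb, r, hr, h₁, h₂⟩
    exact ⟨r, hr, ⟨a, ha, h₁⟩, ⟨b, hb, h₂⟩⟩
  · rintro ⟨r, hr, ⟨a, ha, h₁⟩, ⟨b, hb, h₂⟩⟩
    exact ⟨a, ha, b, hb, r, hr, h₁, h₂⟩

theorem Ncc_exists_rectangle_cover {X Y : Type} [Finite X] (f : X → Y → Bool) :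
    ∃ R : Finset (Set X × Set Y), R.card ≤ 2 ^ Ncc f ∧
      ∀ x y, f x y = true ↔ ∃ r ∈ R, x ∈ r.1 ∧ y ∈ r.2 := by
  obtain ⟨P₀, hP₀⟩ := exists_isNondeterministicFor f
  obtain ⟨P, hP, hc⟩ : Ncc f ∈ {c | ∃ P : RandomizedProtocol X Y,
      P.IsNondeterministicFor f ∧ P.cost = c} := Nat.sInf_mem ⟨_, P₀, hP₀, rfl⟩
  rw [← hc]
  exact hP.exists_rectangle_cover

/-- The fooling set bound. -/
theorem card_le_two_pow_Ncc_of_fooling {X Y ι : Type} [Finite X] [Fintype ι] (f : X → Y → Bool)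
    (x : ι → X) (y : ι → Y) (hone : ∀ i, f (x i) (y i) = true)
    (hfool : ∀ i j, f (x i) (y j) = true → f (x j) (y i) = true → i = j) :
    Fintype.card ι ≤ 2 ^ Ncc f := by
  obtain ⟨R, hc, hR⟩ := Ncc_exists_rectangle_cover f
  choose r hr hx hy using fun i => (hR (x i) (y i)).1 (hone i)
  refine le_trans ?_ hc
  refine Finset.card_le_card_of_injOn r (fun i _ => hr i) (fun i _ j _ hij => ?_)
  -- A rectangle containing two diagonal pairs also contains both crossed pairs.
  refine hfool i j ((hR _ _).2 ⟨r i, hr i, hx i, ?_⟩) ((hR _ _).2 ⟨r i, hr i, ?_, hy i⟩)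
  · rw [hij]; exact hy j
  · rw [hij]; exact hx j

theorem weight_cons {n : ℕ} (b : Bool) (z : Fin n → Bool) :
    weight (Fin.cons b z : Fin (n + 1) → Bool) = b.toNat + weight z := by
  simp only [weight, Finset.card_filter, Fin.sum_univ_succ, Fin.cons_zero, Fin.cons_succ]
  cases b <;> simp

theorem weight_and_cons {n : ℕ} (a b : Bool) (x y : Fin n → Bool) :
    weight (fun i => (Fin.cons a x : Fin (n + 1) → Bool) i && (Fin.cons b y : Fin (n + 1) → Bool) i)
      = (a && b).toNat + weight (fun i => x i && y i) := by
  rw [← weight_cons]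
  congr 1
  funext i
  refine Fin.cases ?_ (fun j => ?_) i <;> simp

/-- The indicator of the letter `k` in the word `w`. The disjoint pairs `(x, y)` of bit strings are
exactly the pairs of indicators of the letters `1` and `2` in a ternary word. -/
def letterIndicator {n : ℕ} (k : Fin 3) (w : Fin n → Fin 3) (i : Fin n) : Bool := decide (w i = k)

theorem letterIndicator_cons {n : ℕ} (k t : Fin 3) (w : Fin n → Fin 3) :
    letterIndicator k (Fin.cons t w : Fin (n + 1) → Fin 3) =
      Fin.cons (decide (t = k)) (letterIndicator k w) := by
  funext i
  refine Fin.cases ?_ (fun j => ?_) i <;> simp [letterIndicator]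

theorem weight_letterIndicator_and {n : ℕ} (w : Fin n → Fin 3) :
    weight (fun i => letterIndicator 1 w i && letterIndicator 2 w i) = 0 := by
  refine Finset.card_eq_zero.2 (Finset.filter_eq_empty_iff.2 fun i _ => ?_)
  simp only [letterIndicator]
  generalize w i = t
  revert t
  decide

open Classical in
/-- A rectangle without pairs `(x, y)` satisfying `|x ∧ y| = 1` contains at most `2 ^ n` disjoint
pairs (Kaibel and Weltge). -/
theorem sum_disjoint_pairs_le {n : ℕ} (A B : Set (Fin n → Bool))
    (h : ∀ x ∈ A, ∀ y ∈ B, weight (fun i => x i && y i) ≠ 1) :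
    ∑ w : Fin n → Fin 3, (if letterIndicator 1 w ∈ A ∧ letterIndicator 2 w ∈ B then 1 else 0)
      ≤ 2 ^ n := by
  induction n with
  | zero =>
    rw [Fintype.sum_unique, pow_zero]
    split_ifs <;> simp
  | succ n ih =>
    let A₀ : Set (Fin n → Bool) := {x | Fin.cons false x ∈ A}
    let A₁ : Set (Fin n → Bool) := {x | Fin.cons true x ∈ A}
    let B₀ : Set (Fin n → Bool) := {y | Fin.cons false y ∈ B}
    let B₁ : Set (Fin n → Bool) := {y | Fin.cons true y ∈ B}
    -- When one of the two leading bits is 0, deleting both preserves the weight of the AND.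
    have hP := ih (A₀ ∪ A₁) B₀ (by
      rintro x (hx | hx) y hy
      · simpa [weight_and_cons] using h _ hx _ hy
      · simpa [weight_and_cons] using h _ hx _ hy)
    have hQ := ih A₀ (B₀ ∪ B₁) (by
      rintro x hx y (hy | hy)
      · simpa [weight_and_cons] using h _ hx _ hy
      · simpa [weight_and_cons] using h _ hx _ hy)
    rw [pow_succ, mul_two]
    refine le_trans ?_ (Nat.add_le_add hP hQ)
    rw [← (Fin.consEquiv fun _ => Fin 3).sum_comp, Fintype.sum_prod_type, Finset.sum_comm,
      ← Finset.sum_add_distrib]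
    refine Finset.sum_le_sum fun w _ => ?_
    -- Prefixing 1 to both halves of a disjoint pair gives weight exactly 1. Hence not all three
    -- extensions of `w` lie in the rectangle, and the two induction bounds account for those that
    -- do.
    have hcross : ¬ (letterIndicator 1 w ∈ A₁ ∧ letterIndicator 2 w ∈ B₁) := fun hw =>
      h _ hw.1 _ hw.2 (by rw [weight_and_cons, weight_letterIndicator_and]; rfl)
    have e₀ (x : Fin n → Bool) : (Fin.cons false x ∈ A) = (x ∈ A₀) := rfl
    have e₁ (x : Fin n → Bool) : (Fin.cons true x ∈ A) = (x ∈ A₁) := rfl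
    have e₂ (x : Fin n → Bool) : (Fin.cons false x ∈ B) = (x ∈ B₀) := rfl
    have e₃ (x : Fin n → Bool) : (Fin.cons true x ∈ B) = (x ∈ B₁) := rfl
    have hcons (k t : Fin 3) : letterIndicator k (Fin.consEquiv (fun _ => Fin 3) (t, w)) =
        Fin.cons (decide (t = k)) (letterIndicator k w) := letterIndicator_cons k t w
    simp only [Fin.sum_univ_three, hcons, Set.mem_union,
      show decide ((0 : Fin 3) = 1) = false from rfl, show decide ((0 : Fin 3) = 2) = false from rfl,
      show decide ((1 : Fin 3) = 2) = false from rfl,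
      show decide ((2 : Fin 3) = 1) = false from rfl,
      e₀, e₂]
    clear hP hQ ih h
    by_cases a₀ : letterIndicator 1 w ∈ A₀ <;> by_cases a₁ : letterIndicator 1 w ∈ A₁ <;>
      by_cases b₀ : letterIndicator 2 w ∈ B₀ <;> by_cases b₁ : letterIndicator 2 w ∈ B₁ <;>
      simp_all

theorem three_pow_le_two_pow_Ncc_fNotOne (n : ℕ) : 3 ^ n ≤ 2 ^ Ncc (fNotOne n) * 2 ^ n := by
  classical
  obtain ⟨R, hc, hR⟩ := Ncc_exists_rectangle_cover (fNotOne n)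
  calc 3 ^ n = ∑ _w : Fin n → Fin 3, 1 := by simp
    _ ≤ ∑ w : Fin n → Fin 3, ∑ r ∈ R,
          (if letterIndicator 1 w ∈ r.1 ∧ letterIndicator 2 w ∈ r.2 then 1 else 0) := by
        refine Finset.sum_le_sum fun w _ => ?_
        obtain ⟨r, hr, hw⟩ := (hR (letterIndicator 1 w) (letterIndicator 2 w)).1
          (by simp [fNotOne, weight_letterIndicator_and])
        refine le_trans ?_ (Finset.single_le_sum (fun _ _ => Nat.zero_le _) hr)
        rw [if_pos hw]
    _ = ∑ r ∈ R, ∑ w : Fin n → Fin 3,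
          (if letterIndicator 1 w ∈ r.1 ∧ letterIndicator 2 w ∈ r.2 then 1 else 0) :=
        Finset.sum_comm
    _ ≤ ∑ _r ∈ R, 2 ^ n := by
        refine Finset.sum_le_sum fun r hr => ?_
        convert sum_disjoint_pairs_le r.1 r.2 fun x hx y hy => ?_
        simpa [fNotOne] using (hR x y).2 ⟨r, hr, hx, hy⟩
    _ ≤ 2 ^ Ncc (fNotOne n) * 2 ^ n := by
        rw [Finset.sum_const, smul_eq_mul]
        exact Nat.mul_le_mul_right _ hc

theorem le_two_mul_Ncc_fNotOne (n : ℕ) : n ≤ 2 * Ncc (fNotOne n) := by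
  -- Squaring replaces `log₂ (3/2)` by the integer comparison `8 ≤ 9`, that is `(3/2) ^ 2 ≥ 2`.
  have h : 2 ^ (3 * n) ≤ 2 ^ (2 * (Ncc (fNotOne n) + n)) :=
    calc 2 ^ (3 * n) = 8 ^ n := by rw [pow_mul]; norm_num
      _ ≤ 9 ^ n := Nat.pow_le_pow_left (by norm_num) n
      _ = (3 ^ n) ^ 2 := by rw [← pow_mul, mul_comm, pow_mul]; norm_num
      _ ≤ (2 ^ Ncc (fNotOne n) * 2 ^ n) ^ 2 :=
        Nat.pow_le_pow_left (three_pow_le_two_pow_Ncc_fNotOne n) 2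
      _ = 2 ^ (2 * (Ncc (fNotOne n) + n)) := by rw [← pow_add, ← pow_mul, mul_comm]
  have := (Nat.pow_le_pow_iff_right (by norm_num : 1 < 2)).1 h
  omega

theorem le_Ncc_complementFn_fNotOne (m : ℕ) : m ≤ Ncc (complementFn (fNotOne (m + 1))) := by
  -- The leading ones contribute 1, so the tails must be disjoint, meaning `z ≤ z'` pointwise;
  -- antisymmetry then gives the fooling property.
  have hval (z z' : Fin m → Bool) : complementFn (fNotOne (m + 1)) (Fin.cons true z)
      (Fin.cons true fun i => !z' i) = true ↔ ∀ i, z i = true → z' i = true := by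
    simp [complementFn, fNotOne, weight_and_cons]
    simp [weight, Finset.filter_eq_empty_iff]
  have h := card_le_two_pow_Ncc_of_fooling (complementFn (fNotOne (m + 1)))
    (fun z : Fin m → Bool => Fin.cons true z) (fun z => Fin.cons true fun i => !z i)
    (fun z => (hval z z).2 fun _ => id)
    (fun z z' h₁ h₂ => funext fun i =>
      Bool.eq_iff_iff.2 ⟨(hval z z').1 h₁ i, (hval z' z).1 h₂ i⟩)
  rw [Fintype.card_fun, Fintype.card_bool, Fintype.card_fin] at h
  exact (Nat.pow_le_pow_iff_right (by norm_num : 1 < 2)).1 h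

theorem theorem3p6 :
    (∃ c : ℝ, 0 < c ∧ ∃ N : ℕ, ∀ n : ℕ, 1 < n → N ≤ n → c * (n : ℝ) ≤ (Ncc (fNotOne n) : ℝ)) ∧
    (∀ n : ℕ, 1 < n → (n : ℝ) - 1 ≤ (Ncc (complementFn (fNotOne n)) : ℝ)) := by
  refine ⟨⟨1 / 2, by norm_num, 0, fun n _ _ => ?_⟩, fun n hn => ?_⟩
  · have h : (n : ℝ) ≤ 2 * Ncc (fNotOne n) := by exact_mod_cast le_two_mul_Ncc_fNotOne n
    linarith
  · obtain ⟨m, rfl⟩ : ∃ m, n = m + 1 := ⟨n - 1, by omega⟩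
    have h : (m : ℝ) ≤ Ncc (complementFn (fNotOne (m + 1))) := by
      exact_mod_cast le_Ncc_complementFn_fNotOne m
    push_cast
    linarith
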